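/- For $\ell\ge 1$, $\lambda>0$ and $\underline h=(h_1,\dots,h_\ell)\in\mathbb R^\ell$ let $$Z_{\ell,\underline h}=\sum_{\sigma\in\{-1,1\}^{\ell}}\exp\Big\{\sum_{i=1}^{\ell}\big(\lambda\sigma(i)\sigma(i+1)+h_i\sigma(i)\big)\Big\},\qquad \sigma(\ell+1):=\sigma(1),$$ and $m_i=m_i(\underline h)=\partial \log Z_{\ell,\underline h}/\partial h_i$. Let $\Delta=\{1,\dots,\ell\}^2$, $|\Delta|=\ell^2$, let $\mathcal M_\ell=\{-1,-1+\frac2\ell,\dots,1\}$ and, for $\underline m=(m_1,\dots,m_\ell)\in\mathcal M_\ell^\ell$, let $$\phi_\ell(\underline m)=-\frac1{|\Delta|}\log\sum_{\sigma\in\{-1,1\}^\Delta}e^{\lambda\sum_{x,i=1}^{\ell}\sigma(x,i)\sigma(x,i+1)}\,\mathbf 1_{\{\sum_x\sigma(x,i)=\ell m_i\ \text{for all } i\}},\qquad \sigma(x,\ell+1):=\sigma(x,1).$$ For $h_{\rm ext}\in\mathbb R$ and $m_+\in(0,1)$ let $$\log Z^{\max}_\Delta=\max_{\underline m\in\mathcal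 M_\ell^\ell:\ |m_i|\le m_+\ \forall i}\ \sum_{(x,i)\in\Delta}\Big\{\frac{m_i^2}2+h_{\rm ext}m_i-\phi_\ell(\underline m)\Big\}$$ (the set of such $\underline m$ is non-empty as soon as $\ell m_+\ge 1$). Let $h^*>3$ be the solution of $3/\cosh^2(h^*-3)=\frac14$. Let $S(m)=-\frac{1+m}2\log\frac{1+m}2-\frac{1-m}2\log\frac{1-m}2$, and let $m^*\in(0,1)$ be the solution of $-[S'(m^*)+m^*]=h^*$. **Theorem.** For every $m_+\in(m^*,1)$ there is $\lambda_0>0$ such that the following holds for every $\lambda\in(0,\lambda_0)$. There is $h_+>0$ such that, for all $\ell\ge1$, every $\underline h\in\mathbb R^\ell$ with $|m_i(\underline h)|\le m_+$ for all $i$ satisfies $|h_i|\le h_+$ for all $i$. For every such $h_+$ and every $h_{\rm ext}\in[0,h^*]$ the following two limits exist in $\mathbb R$, the maximum on the right is attained for every $\ell\ge1$, and $$\lim_{\ell\to\infty}\frac1{|\Delta|}\log Z^{\max}_\Delta=\lim_{\ell\to\infty}\frac1\ell\max_{\underline h:\ |h_i|\le h_+\ \forall i}\Big\{\sum_{i=1}^\ell\Big[\frac{m_i^2}2+(h_{\rm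 ext}-h_i)m_i\Big]+\log Z_{\ell,\underline h}\Big\},\qquad m_i=m_i(\underline h).$$ -/

import Mathlib

open Filter Topology

namespace LayeredIsing

noncomputable section

/-- The real value `±1` of a spin. -/
def spin (s : ℤˣ) : ℝ := ((s : ℤ) : ℝ)

/-- The vertical nearest neighbour energy of a configuration `σ x i` on the `ℓ × ℓ` square
(`x` is the column and `i` the layer), with `σ x (ℓ + 1) = σ x 1`. -/
def vertEnergy (lam : ℝ) (ℓ : ℕ) (σ : Fin ℓ → Fin ℓ → ℤˣ) : ℝ :=
  ∑ x, (-lam * ∑ i, spin (σ x i) * spin (σ x (finRotate ℓ i)))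

/-- The possible values `-1, -1 + 2/ℓ, …, 1` of the empirical magnetization of `ℓ` spins. -/
def magValues (ℓ : ℕ) : Set ℝ :=
  {m | ∃ k : ℕ, k ≤ ℓ ∧ m = -1 + 2 * (k : ℝ) / (ℓ : ℝ)}

open Classical in
/-- The multi-canonical partition function on the `ℓ × ℓ` square: the sum over the
configurations whose empirical magnetization in the layer `i` is `m i`, for every `i`. -/
def multiCanonicalZ (lam : ℝ) (ℓ : ℕ) (m : Fin ℓ → ℝ) : ℝ :=
  ∑ σ : Fin ℓ → Fin ℓ → ℤˣ,
    if ∀ i, ∑ x, spin (σ x i) = (ℓ : ℝ) * m i then Real.exp (-vertEnergy lam ℓ σ) else 0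

/-- The multi-canonical free energy density `φ_ℓ(m)`. -/
def multiCanonicalPhi (lam : ℝ) (ℓ : ℕ) (m : Fin ℓ → ℝ) : ℝ :=
  -(1 / (ℓ : ℝ) ^ 2) * Real.log (multiCanonicalZ lam ℓ m)

/-- The layer magnetizations admitted in the multi-canonical variational problem. -/
def admissibleMag (mplus : ℝ) (ℓ : ℕ) : Set (Fin ℓ → ℝ) :=
  {m | ∀ i, m i ∈ magValues ℓ ∧ |m i| ≤ mplus}

/-- `log Z^max` on the `ℓ × ℓ` square. The supremum is over a finite set, which is non-empty
once `1 ≤ ℓ * mplus`. -/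
def logZmax (lam hext mplus : ℝ) (ℓ : ℕ) : ℝ :=
  sSup ((fun m : Fin ℓ → ℝ =>
      ∑ _x : Fin ℓ, ∑ i : Fin ℓ,
        (m i ^ 2 / 2 + hext * m i - multiCanonicalPhi lam ℓ m)) ''
    admissibleMag mplus ℓ)

/-- The partition function `Z_{ℓ,h}` of the Ising ring with `ℓ` sites, coupling `lam` and
site dependent magnetic field `h`. -/
def ringZ (lam : ℝ) (ℓ : ℕ) (h : Fin ℓ → ℝ) : ℝ :=
  ∑ s : Fin ℓ → ℤˣ,
    Real.exp (∑ i, (lam * spin (s i) * spin (s (finRotate ℓ i)) + h i * spin (s i)))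

/-- The magnetization `m_i(h) = ∂ log Z_{ℓ,h} / ∂ h_i`. -/
def mag (lam : ℝ) (ℓ : ℕ) (h : Fin ℓ → ℝ) (i : Fin ℓ) : ℝ :=
  deriv (fun t : ℝ => Real.log (ringZ lam ℓ (Function.update h i t))) (h i)

/-- The functional of the auxiliary layer fields which is to be maximized. -/
def fieldFunctional (lam hext : ℝ) (ℓ : ℕ) (h : Fin ℓ → ℝ) : ℝ :=
  ∑ i, (mag lam ℓ h i ^ 2 / 2 + (hext - h i) * mag lam ℓ h i) + Real.log (ringZ lam ℓ h)

/-- The fields all of whose components are bounded by `hplus`. -/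
def boundedFields (hplus : ℝ) (ℓ : ℕ) : Set (Fin ℓ → ℝ) :=
  {h | ∀ i, |h i| ≤ hplus}

/-- `hplus` bounds, uniformly in `ℓ`, all components of every field whose magnetizations are
bounded by `mplus`. -/
def IsFieldBound (lam mplus hplus : ℝ) : Prop :=
  ∀ ℓ : ℕ, 1 ≤ ℓ → ∀ h : Fin ℓ → ℝ, (∀ i, |mag lam ℓ h i| ≤ mplus) → h ∈ boundedFields hplus ℓ

/-- The entropy `S(m)` of the free Ising model. -/
def entropy (m : ℝ) : ℝ :=
  -((1 + m) / 2 * Real.log ((1 + m) / 2) + (1 - m) / 2 * Real.log ((1 - m) / 2))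

end

end LayeredIsing

namespace LayeredIsing

noncomputable section

/-! Both limits equal P = max over t in [-1,1] of log Λ(t + hext) - t²/2, where Λ = `perron lam` is
the largest eigenvalue of the transfer matrix. Upper bounds: a Legendre-type inequality with the
field m_i + hext bounds each functional by log Z(m + hext) - Σ m_i²/2, up to a factor ℓ in the
canonical case. It comes from convexity of log Z for fields (`log_ringZ_add_ge`), and from
discarding all but one magnetization vector in Z^ℓ for the canonical sum
(`multiCanonicalZ_mul_exp_le`). All transfer matrices are self-adjoint for one common quadratic
form, so Z(h) ≤ C ∏ Λ(h_i) with C independent of ℓ (`ringZ_le`). The layers decouple, and each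
contributes at most P. Lower bounds: let t₀ be a maximizer and take the constant field t₀ + hext,
for which Z ≥ Λ^ℓ. For fields, m²/2 - t₀m ≥ -t₀²/2 suffices. For the canonical sum, Chernoff's bound
keeps half of Z^ℓ on admissible magnetizations, and there are only (ℓ+1)^ℓ magnetization vectors, a
cost of order ℓ log ℓ against ℓ². The constraint m₊ does not bind: for small λ, t₀ + hext ≤ a with
tanh(a + 2λ) < m₊ (`exists_max_pressure`), and |m_i| ≤ tanh(a + 2λ) by a single spin flip
(`mag_le_tanh`). -/

lemma spin_eq_or (s : ℤˣ) : spin s = 1 ∨ spin s = -1 := by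
  rcases Int.units_eq_one_or s with rfl | rfl <;> simp [spin]

lemma spin_neg (s : ℤˣ) : spin (-s) = -spin s := by
  simp [spin]

/-! ### Gibbs measure of the ring: magnetizations and convexity of log Z. -/

/-- The Gibbs weight of a configuration on the Ising ring. -/
def gibbsWeight (lam : ℝ) (ℓ : ℕ) (h : Fin ℓ → ℝ) (s : Fin ℓ → ℤˣ) : ℝ :=
  Real.exp (∑ i, (lam * spin (s i) * spin (s (finRotate ℓ i)) + h i * spin (s i)))

lemma gibbsWeight_pos (lam : ℝ) (ℓ : ℕ) (h : Fin ℓ → ℝ) (s : Fin ℓ → ℤˣ) :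
    0 < gibbsWeight lam ℓ h s := Real.exp_pos _

lemma ringZ_eq_sum (lam : ℝ) (ℓ : ℕ) (h : Fin ℓ → ℝ) :
    ringZ lam ℓ h = ∑ s, gibbsWeight lam ℓ h s := rfl

lemma ringZ_pos (lam : ℝ) (ℓ : ℕ) (h : Fin ℓ → ℝ) : 0 < ringZ lam ℓ h :=
  Finset.sum_pos (fun s _ => gibbsWeight_pos lam ℓ h s) Finset.univ_nonempty

lemma gibbsWeight_add (lam : ℝ) (ℓ : ℕ) (h v : Fin ℓ → ℝ) (s : Fin ℓ → ℤˣ) :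
    gibbsWeight lam ℓ (h + v) s = gibbsWeight lam ℓ h s * Real.exp (∑ i, v i * spin (s i)) := by
  rw [gibbsWeight, gibbsWeight, ← Real.exp_add, ← Finset.sum_add_distrib]
  congr 1
  exact Finset.sum_congr rfl fun i _ => by simp only [Pi.add_apply]; ring

lemma gibbsWeight_add_single (lam : ℝ) (ℓ : ℕ) (h : Fin ℓ → ℝ) (i : Fin ℓ) (t : ℝ)
    (s : Fin ℓ → ℤˣ) :
    gibbsWeight lam ℓ (h + Pi.single i t) s
      = gibbsWeight lam ℓ h s * Real.exp (t * spin (s i)) := by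
  rw [gibbsWeight_add]
  congr 2
  rw [Finset.sum_eq_single i] <;> simp +contextual

lemma mag_eq (lam : ℝ) (ℓ : ℕ) (h : Fin ℓ → ℝ) (i : Fin ℓ) :
    mag lam ℓ h i = (∑ s, spin (s i) * gibbsWeight lam ℓ h s) / ringZ lam ℓ h := by
  have hup : ∀ t, Function.update h i t = h + Pi.single i (t - h i) := by
    intro t
    ext j
    by_cases hj : j = i
    · subst hj; simp
    · simp [hj]
  have hfun : (fun t => ringZ lam ℓ (Function.update h i t))
      = fun t => ∑ s, gibbsWeight lam ℓ h s * Real.exp ((t - h i) * spin (s i)) := by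
    funext t
    rw [hup, ringZ_eq_sum]
    exact Finset.sum_congr rfl fun s _ => gibbsWeight_add_single ..
  have hd : HasDerivAt (fun t => ringZ lam ℓ (Function.update h i t))
      (∑ s, spin (s i) * gibbsWeight lam ℓ h s) (h i) := by
    rw [hfun]
    refine HasDerivAt.fun_sum fun s _ => ?_
    have h1 : HasDerivAt (fun t : ℝ => (t - h i) * spin (s i)) (spin (s i)) (h i) := by
      simpa using ((hasDerivAt_id (h i)).sub_const (h i)).mul_const (spin (s i))
    have h2 := (h1.exp).const_mul (gibbsWeight lam ℓ h s)
    simpa [mul_comm] using h2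
  have hz : ringZ lam ℓ (Function.update h i (h i)) = ringZ lam ℓ h := by simp
  have := (hd.log (by rw [hz]; exact (ringZ_pos ..).ne')).deriv
  rw [mag, this, hz]

lemma mag_mul_ringZ (lam : ℝ) (ℓ : ℕ) (h : Fin ℓ → ℝ) (i : Fin ℓ) :
    mag lam ℓ h i * ringZ lam ℓ h = ∑ s, spin (s i) * gibbsWeight lam ℓ h s := by
  rw [mag_eq, div_mul_cancel₀ _ (ringZ_pos ..).ne']

/-- Convexity of `log Z` (Jensen's inequality for the Gibbs measure). -/
lemma ringZ_add_ge (lam : ℝ) (ℓ : ℕ) (h v : Fin ℓ → ℝ) :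
    ringZ lam ℓ h * Real.exp (∑ i, v i * mag lam ℓ h i) ≤ ringZ lam ℓ (h + v) := by
  set c := ∑ i, v i * mag lam ℓ h i with hc
  have hcz : c * ringZ lam ℓ h = ∑ s, (∑ i, v i * spin (s i)) * gibbsWeight lam ℓ h s := by
    simp_rw [hc, Finset.sum_mul, mul_assoc, mag_mul_ringZ, Finset.mul_sum]
    exact Finset.sum_comm
  have hle : ∀ s, gibbsWeight lam ℓ h s * (Real.exp c * (1 + (∑ i, v i * spin (s i)) - c))
      ≤ gibbsWeight lam ℓ (h + v) s := by
    intro s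
    rw [gibbsWeight_add]
    refine mul_le_mul_of_nonneg_left ?_ (gibbsWeight_pos ..).le
    have h1 := Real.add_one_le_exp ((∑ i, v i * spin (s i)) - c)
    have h2 : Real.exp (∑ i, v i * spin (s i))
        = Real.exp c * Real.exp ((∑ i, v i * spin (s i)) - c) := by
      rw [← Real.exp_add]; ring_nf
    rw [h2]
    refine mul_le_mul_of_nonneg_left (by linarith) (Real.exp_pos c).le
  have hsum : ∑ s, gibbsWeight lam ℓ h s * (Real.exp c * (1 + (∑ i, v i * spin (s i)) - c))
      = ringZ lam ℓ h * Real.exp c := by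
    have : ∀ s, gibbsWeight lam ℓ h s * (Real.exp c * (1 + (∑ i, v i * spin (s i)) - c))
        = Real.exp c * ((1 - c) * gibbsWeight lam ℓ h s
          + (∑ i, v i * spin (s i)) * gibbsWeight lam ℓ h s) := fun s => by ring
    simp_rw [this]
    rw [← Finset.mul_sum, Finset.sum_add_distrib, ← Finset.mul_sum, ← ringZ_eq_sum, ← hcz]
    ring
  rw [← hsum, ringZ_eq_sum]
  exact Finset.sum_le_sum fun s _ => hle s

lemma log_ringZ_add_ge (lam : ℝ) (ℓ : ℕ) (h v : Fin ℓ → ℝ) :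
    Real.log (ringZ lam ℓ h) + ∑ i, v i * mag lam ℓ h i ≤ Real.log (ringZ lam ℓ (h + v)) := by
  have := Real.log_le_log (mul_pos (ringZ_pos ..) (Real.exp_pos _)) (ringZ_add_ge lam ℓ h v)
  rwa [Real.log_mul (ringZ_pos ..).ne' (Real.exp_pos _).ne', Real.log_exp] at this

lemma mag_mem (lam : ℝ) (ℓ : ℕ) (h : Fin ℓ → ℝ) (i : Fin ℓ) :
    mag lam ℓ h i ∈ Set.Icc (-1 : ℝ) 1 := by
  have hZ := ringZ_pos lam ℓ h
  rw [mag_eq, Set.mem_Icc, le_div_iff₀ hZ, div_le_iff₀ hZ, ringZ_eq_sum, Finset.mul_sum,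
    Finset.mul_sum]
  constructor <;> refine Finset.sum_le_sum fun s _ =>
    mul_le_mul_of_nonneg_right ?_ (gibbsWeight_pos ..).le
  · rcases spin_eq_or (s i) with h | h <;> norm_num [h]
  · rcases spin_eq_or (s i) with h | h <;> norm_num [h]

/-! ### Comparison of magnetizations with free spins, and the field bound. -/

/-- The configuration with the spin at `i` reversed. -/
def flip {ℓ : ℕ} (i : Fin ℓ) (s : Fin ℓ → ℤˣ) : Fin ℓ → ℤˣ := Function.update s i (-s i)

lemma flip_involutive {ℓ : ℕ} (i : Fin ℓ) : Function.Involutive (flip i) := by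
  intro s
  simp [flip]

/-- Only the bonds leaving and entering i can change, each by at most 2λ. -/
lemma gibbsWeight_le_flip {lam : ℝ} (hlam : 0 ≤ lam) (ℓ : ℕ) (h : Fin ℓ → ℝ) (i : Fin ℓ)
    (s : Fin ℓ → ℤˣ) :
    gibbsWeight lam ℓ h s
      ≤ Real.exp (2 * h i * spin (s i) + 4 * lam) * gibbsWeight lam ℓ h (flip i s) := by
  rw [gibbsWeight, gibbsWeight, ← Real.exp_add, Real.exp_le_exp, ← sub_le_iff_le_add,
    ← Finset.sum_sub_distrib]
  -- The two indicators are charged separately, so the self-bond at ℓ = 1, where both hold for the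
  -- same j, is covered.
  have hterm : ∀ j, (lam * spin (s j) * spin (s (finRotate ℓ j)) + h j * spin (s j))
      - (lam * spin (flip i s j) * spin (flip i s (finRotate ℓ j)) + h j * spin (flip i s j))
      ≤ (if j = i then 2 * h i * spin (s i) + 2 * lam else 0)
        + (if finRotate ℓ j = i then 2 * lam else 0) := by
    intro j
    by_cases h1 : j = i
    · have hA : spin (flip i s j) = - spin (s i) := by simp [flip, h1, spin_neg]
      have hB : spin (flip i s (finRotate ℓ j)) = spin (s (finRotate ℓ j)) ∨
          spin (flip i s (finRotate ℓ j)) = -spin (s (finRotate ℓ j)) := by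
        by_cases h2 : finRotate ℓ j = i
        · right; simp [flip, h2, spin_neg]
        · left; exact congrArg spin (Function.update_of_ne h2 _ _)
      have hC : lam * spin (s i) * spin (s (finRotate ℓ j)) ≤ lam := by
        rcases spin_eq_or (s i) with h | h <;> rcases spin_eq_or (s (finRotate ℓ j)) with h' | h' <;>
          rw [h, h'] <;> linarith
      have hD : 0 ≤ if finRotate ℓ j = i then 2 * lam else 0 := by split_ifs <;> linarith
      rw [hA, if_pos h1, h1] at *
      rcases hB with hB | hB <;> rw [hB] <;> nlinarith
    · have hA : spin (flip i s j) = spin (s j) := by simp [flip, h1]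
      rw [hA, if_neg h1]
      by_cases h2 : finRotate ℓ j = i
      · have hB : spin (flip i s (finRotate ℓ j)) = -spin (s (finRotate ℓ j)) := by
          simp [flip, h2, spin_neg]
        rw [hB, if_pos h2]
        rcases spin_eq_or (s j) with h | h <;> rcases spin_eq_or (s (finRotate ℓ j)) with h' | h' <;>
          rw [h, h'] <;> linarith
      · have hB : spin (flip i s (finRotate ℓ j)) = spin (s (finRotate ℓ j)) :=
          congrArg spin (Function.update_of_ne h2 _ _)
        rw [hB, if_neg h2]
        linarith
  refine (Finset.sum_le_sum fun j _ => hterm j).trans ?_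
  rw [Finset.sum_add_distrib, Finset.sum_ite_eq' Finset.univ i,
    Equiv.sum_comp (finRotate ℓ) (fun j => if j = i then 2 * lam else 0),
    Finset.sum_ite_eq' Finset.univ i]
  simp
  linarith

lemma le_tanh_of {m a : ℝ} (h : 1 + m ≤ Real.exp (2 * a) * (1 - m)) : m ≤ Real.tanh a := by
  have hp := Real.exp_pos a
  have hn := Real.exp_pos (-a)
  have he : Real.exp (2 * a) * Real.exp (-a) = Real.exp a := by
    rw [← Real.exp_add]; ring_nf
  rw [Real.tanh_eq, le_div_iff₀ (by positivity)]
  have := mul_le_mul_of_nonneg_right h hn.le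
  have h2 : Real.exp (2 * a) * (1 - m) * Real.exp (-a) = Real.exp a * (1 - m) := by
    rw [← he]; ring
  rw [h2] at this
  linarith

/-- Flipping the spin at i pairs up with down configurations, so the odds of up against down are at
most exp(2(h_i + 2λ)), the odds of a free spin in the field h_i + 2λ. -/
lemma mag_le_tanh {lam : ℝ} (hlam : 0 ≤ lam) (ℓ : ℕ) (h : Fin ℓ → ℝ) (i : Fin ℓ) :
    mag lam ℓ h i ≤ Real.tanh (h i + 2 * lam) := by
  refine le_tanh_of ?_
  have hZ := ringZ_pos lam ℓ h
  have key : ∑ s, (1 + spin (s i)) * gibbsWeight lam ℓ h s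
      ≤ Real.exp (2 * (h i + 2 * lam)) * ∑ s, (1 - spin (s i)) * gibbsWeight lam ℓ h s := by
    rw [← Equiv.sum_comp ((flip_involutive i).toPerm (flip i))
      (fun s => (1 - spin (s i)) * gibbsWeight lam ℓ h s), Finset.mul_sum]
    refine Finset.sum_le_sum fun s _ => ?_
    have hs : spin (flip i s i) = - spin (s i) := by simp [flip, spin_neg]
    have hf := gibbsWeight_le_flip hlam ℓ h i s
    simp only [Function.Involutive.coe_toPerm, hs]
    rcases spin_eq_or (s i) with h' | h' <;> rw [h'] at hf ⊢
    · calc (1 + 1) * gibbsWeight lam ℓ h s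
          ≤ (1 + 1) * _ := mul_le_mul_of_nonneg_left hf (by norm_num)
        _ = _ := by ring_nf
    · simp
  have e1 : (1 + mag lam ℓ h i) * ringZ lam ℓ h = ∑ s, (1 + spin (s i)) * gibbsWeight lam ℓ h s := by
    simp_rw [add_mul, Finset.sum_add_distrib, mag_mul_ringZ, one_mul, ringZ_eq_sum]
  have e2 : (1 - mag lam ℓ h i) * ringZ lam ℓ h = ∑ s, (1 - spin (s i)) * gibbsWeight lam ℓ h s := by
    simp_rw [sub_mul, Finset.sum_sub_distrib, mag_mul_ringZ, one_mul, ringZ_eq_sum]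
  rw [← e1, ← e2, ← mul_assoc] at key
  exact le_of_mul_le_mul_right key hZ

lemma gibbsWeight_neg (lam : ℝ) (ℓ : ℕ) (h : Fin ℓ → ℝ) (s : Fin ℓ → ℤˣ) :
    gibbsWeight lam ℓ (-h) (-s) = gibbsWeight lam ℓ h s := by
  simp [gibbsWeight, spin_neg]

lemma ringZ_neg (lam : ℝ) (ℓ : ℕ) (h : Fin ℓ → ℝ) : ringZ lam ℓ (-h) = ringZ lam ℓ h := by
  rw [ringZ_eq_sum, ringZ_eq_sum, ← Equiv.sum_comp (Equiv.neg _)]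
  exact Finset.sum_congr rfl fun s _ => gibbsWeight_neg ..

lemma mag_neg (lam : ℝ) (ℓ : ℕ) (h : Fin ℓ → ℝ) (i : Fin ℓ) :
    mag lam ℓ (-h) i = -mag lam ℓ h i := by
  rw [mag_eq, mag_eq, ringZ_neg, ← Equiv.sum_comp (Equiv.neg _), ← neg_div, ← Finset.sum_neg_distrib]
  congr 1
  refine Finset.sum_congr rfl fun s _ => ?_
  simp [gibbsWeight_neg, spin_neg]

lemma tanh_le_mag {lam : ℝ} (hlam : 0 ≤ lam) (ℓ : ℕ) (h : Fin ℓ → ℝ) (i : Fin ℓ) :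
    Real.tanh (h i - 2 * lam) ≤ mag lam ℓ h i := by
  have := mag_le_tanh hlam ℓ (-h) i
  rw [mag_neg, Pi.neg_apply, show -h i + 2 * lam = -(h i - 2 * lam) by ring, Real.tanh_neg] at this
  linarith

lemma tanh_strictMono : StrictMono Real.tanh := by
  intro a b hab
  rwa [← Real.artanh_lt_artanh_iff ⟨Real.neg_one_lt_tanh a, Real.tanh_lt_one a⟩
    ⟨Real.neg_one_lt_tanh b, Real.tanh_lt_one b⟩, Real.artanh_tanh, Real.artanh_tanh]

lemma exists_isFieldBound {lam mplus : ℝ} (hlam : 0 < lam) (hm : mplus ∈ Set.Ioo (0 : ℝ) 1) :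
    ∃ hplus : ℝ, 0 < hplus ∧ IsFieldBound lam mplus hplus := by
  have ht : Real.tanh (Real.artanh mplus) = mplus := Real.tanh_artanh ⟨by linarith [hm.1], hm.2⟩
  -- Inverts tanh(|h_i| - 2λ) ≤ |m_i| ≤ m₊; no dependence on ℓ enters.
  refine ⟨Real.artanh mplus + 2 * lam, by linarith [Real.artanh_pos hm], ?_⟩
  intro ℓ _ h hh i
  have h1 := mag_le_tanh hlam.le ℓ h i
  have h2 := tanh_le_mag hlam.le ℓ h i
  have h3 := abs_le.1 (hh i)
  rw [← ht] at h3
  rw [abs_le]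
  constructor
  · rw [← Real.tanh_neg] at h3
    linarith [tanh_strictMono.le_iff_le.1 (h3.1.trans h1)]
  · linarith [tanh_strictMono.le_iff_le.1 (h2.trans h3.2)]

/-! ### Continuity and attainment of the field maximum. -/

lemma continuous_gibbsWeight (lam : ℝ) (ℓ : ℕ) (s : Fin ℓ → ℤˣ) :
    Continuous fun h => gibbsWeight lam ℓ h s := by
  unfold gibbsWeight
  fun_prop

lemma continuous_ringZ (lam : ℝ) (ℓ : ℕ) : Continuous (ringZ lam ℓ) :=
  continuous_finsetSum _ fun s _ => continuous_gibbsWeight lam ℓ s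

lemma continuous_mag (lam : ℝ) (ℓ : ℕ) (i : Fin ℓ) : Continuous fun h => mag lam ℓ h i := by
  simp_rw [mag_eq]
  exact (continuous_finsetSum _ fun s _ => (continuous_gibbsWeight lam ℓ s).const_mul _).div
    (continuous_ringZ lam ℓ) fun h => (ringZ_pos ..).ne'

lemma continuous_fieldFunctional (lam hext : ℝ) (ℓ : ℕ) :
    Continuous (fieldFunctional lam hext ℓ) := by
  unfold fieldFunctional
  refine Continuous.add (continuous_finsetSum _ fun i _ => ?_)
    ((continuous_ringZ lam ℓ).log fun h => (ringZ_pos ..).ne')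
  have := continuous_mag lam ℓ i
  fun_prop

lemma exists_isGreatest_fieldFunctional (lam hext : ℝ) {hplus : ℝ} (hp : 0 < hplus) (ℓ : ℕ) :
    ∃ M, IsGreatest (fieldFunctional lam hext ℓ '' boundedFields hplus ℓ) M := by
  have hb : boundedFields hplus ℓ = Set.Icc (fun _ => -hplus) (fun _ => hplus) := by
    ext h
    simp [boundedFields, abs_le, Pi.le_def, forall_and]
  have hne : (boundedFields hplus ℓ).Nonempty := ⟨0, fun i => by simp [hp.le]⟩
  have hc : IsCompact (boundedFields hplus ℓ) := hb ▸ isCompact_Icc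
  exact (hc.image (continuous_fieldFunctional lam hext ℓ)).exists_isGreatest (hne.image _)


/-! ### Transfer matrices: bounding Z by largest eigenvalues. -/

lemma list_ofFn_prod_apply {α : Type*} [Fintype α] [DecidableEq α] (n : ℕ)
    (M : Fin (n + 1) → Matrix α α ℝ) (a b : α) :
    (List.ofFn M).prod a b = ∑ s : Fin n → α,
      ∏ i, M i (Fin.cons (α := fun _ => α) a s i) (Fin.snoc (α := fun _ => α) s b i) := by
  induction n generalizing a with
  | zero => simp [Fin.snoc]
  | succ n ih =>
    rw [List.ofFn_succ, List.prod_cons, Matrix.mul_apply,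
      ← Equiv.sum_comp (Fin.consEquiv fun _ : Fin (n + 1) => α), Fintype.sum_prod_type]
    refine Finset.sum_congr rfl fun c _ => ?_
    rw [ih, Finset.mul_sum]
    refine Finset.sum_congr rfl fun s _ => ?_
    rw [Fin.prod_univ_succ (n := n + 1)]
    simp only [Fin.consEquiv, Equiv.coe_fn_mk, ← Fin.cons_snoc_eq_snoc_cons, Fin.cons_zero,
      Fin.cons_succ]

/-- The transfer matrix of the Ising ring. -/
def transfer (lam h : ℝ) : Matrix ℤˣ ℤˣ ℝ :=
  Matrix.of fun a b => Real.exp (lam * spin a * spin b + h * spin a)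

lemma ringZ_eq_trace (lam : ℝ) (n : ℕ) (h : Fin (n + 1) → ℝ) :
    ringZ lam (n + 1) h = (List.ofFn fun i => transfer lam (h i)).prod.trace := by
  rw [Matrix.trace, ringZ_eq_sum,
    ← Equiv.sum_comp (Fin.consEquiv fun _ : Fin (n + 1) => ℤˣ), Fintype.sum_prod_type]
  refine Finset.sum_congr rfl fun a _ => ?_
  rw [Matrix.diag_apply, list_ofFn_prod_apply]
  refine Finset.sum_congr rfl fun s _ => ?_
  rw [gibbsWeight, Real.exp_sum]
  refine Finset.prod_congr rfl fun i _ => ?_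
  -- On the diagonal the path closes up: the end points are the start points rotated, which is the
  -- periodic boundary condition.
  rw [Fin.snoc_eq_cons_rotate]
  rfl

/-- The largest eigenvalue of the transfer matrix. -/
def perron (lam h : ℝ) : ℝ :=
  Real.exp lam * Real.cosh h
    + √(Real.exp (2 * lam) * Real.sinh h ^ 2 + Real.exp (-(2 * lam)))

lemma perron_pos (lam h : ℝ) : 0 < perron lam h := by
  have := Real.exp_pos lam
  have := Real.cosh_pos h
  unfold perron
  positivity

lemma exp_two_mul (x : ℝ) : Real.exp (2 * x) = Real.exp x ^ 2 := by
  rw [← Real.exp_nat_mul]; norm_num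

lemma sqrt_perron_sq (lam h : ℝ) :
    √(Real.exp (2 * lam) * Real.sinh h ^ 2 + Real.exp (-(2 * lam))) ^ 2
      = Real.exp lam ^ 2 * Real.sinh h ^ 2 + Real.exp (-lam) ^ 2 := by
  rw [Real.sq_sqrt (by positivity), exp_two_mul, ← exp_two_mul (-lam), mul_neg]

lemma perron_sq (lam h : ℝ) :
    perron lam h ^ 2 = 2 * Real.exp lam * Real.cosh h * perron lam h
      - (Real.exp lam ^ 2 - Real.exp (-lam) ^ 2) := by
  have h1 := sqrt_perron_sq lam h
  have h2 := Real.cosh_sq h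
  unfold perron
  linear_combination h1 + Real.exp lam ^ 2 * (-h2)

lemma exp_mul_exp_le_perron (lam h : ℝ) : Real.exp lam * Real.exp h ≤ perron lam h := by
  have h1 := sqrt_perron_sq lam h
  have h2 : Real.exp lam * Real.sinh h ≤
      √(Real.exp (2 * lam) * Real.sinh h ^ 2 + Real.exp (-(2 * lam))) := by
    refine Real.le_sqrt_of_sq_le ?_
    rw [exp_two_mul, mul_pow]
    linarith [Real.exp_pos (-(2 * lam))]
  rw [← Real.cosh_add_sinh h, perron]
  linarith

/-- The quadratic form for which the transfer matrices are self-adjoint. -/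
def transferForm (lam : ℝ) (u : ℤˣ → ℝ) : ℝ :=
  Real.exp lam * (u 1 ^ 2 + u (-1) ^ 2) + 2 * Real.exp (-lam) * (u 1 * u (-1))

lemma sum_units_int (f : ℤˣ → ℝ) : ∑ a, f a = f 1 + f (-1) := by
  rw [show (Finset.univ : Finset ℤˣ) = {1, -1} from rfl, Finset.sum_pair (by decide)]

lemma spin_one : spin 1 = 1 := by simp [spin]

lemma spin_neg_one : spin (-1) = -1 := by simp [spin]

/-- The transfer matrix is T = DK with D = diag(e^h, e^{-h}) and K, positive definite for λ > 0, the
matrix of the form. Since KDK is symmetric, T is self-adjoint for K, so its norm is its largest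
eigenvalue. The form does not depend on h, so the bounds multiply along products with varying
fields. -/
lemma transferForm_mulVec_le {lam : ℝ} (hlam : 0 < lam) (h : ℝ) (u : ℤˣ → ℝ) :
    transferForm lam ((transfer lam h).mulVec u) ≤ perron lam h ^ 2 * transferForm lam u := by
  have hsq := perron_sq lam h
  have hL := perron_pos lam h
  have hg := exp_mul_exp_le_perron lam h
  have hEF : Real.exp (-lam) < Real.exp lam := Real.exp_lt_exp.2 (by linarith)
  have hgk : Real.exp h * Real.exp (-h) = 1 := by rw [← Real.exp_add]; simp
  have hE := Real.exp_pos lam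
  have hF := Real.exp_pos (-lam)
  have hgp := Real.exp_pos h
  have hkp := Real.exp_pos (-h)
  have hcosh : 2 * Real.cosh h = Real.exp h + Real.exp (-h) := by rw [Real.cosh_eq]; ring
  have e1 : (transfer lam h).mulVec u 1
      = Real.exp h * (Real.exp lam * u 1 + Real.exp (-lam) * u (-1)) := by
    simp [Matrix.mulVec, dotProduct, transfer, spin_one, spin_neg_one, Real.exp_add]
    ring
  have e2 : (transfer lam h).mulVec u (-1)
      = Real.exp (-h) * (Real.exp (-lam) * u 1 + Real.exp lam * u (-1)) := by
    simp [Matrix.mulVec, dotProduct, transfer, spin_one, spin_neg_one, Real.exp_add]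
    ring
  rw [transferForm, transferForm, e1, e2]
  have hsq' : perron lam h ^ 2 = Real.exp lam * (Real.exp h + Real.exp (-h)) * perron lam h
      - (Real.exp lam ^ 2 - Real.exp (-lam) ^ 2) := by
    rw [hsq, ← hcosh]; ring
  clear hsq hcosh e1 e2
  generalize perron lam h = L at *
  generalize Real.exp lam = E at *
  generalize Real.exp (-lam) = F at *
  generalize Real.exp h = g at *
  generalize Real.exp (-h) = k at *
  generalize u 1 = x
  generalize u (-1) = y
  set X := E * x + F * y with hX
  set Y := F * x + E * y with hY
  have hd : 0 < E ^ 2 - F ^ 2 := by nlinarith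
  set d := E ^ 2 - F ^ 2 with hdd
  have hα : 0 < L * E - d * g := by
    have : E * g * E ≤ L * E := mul_le_mul_of_nonneg_right hg hE.le
    have : 0 < F ^ 2 * g := by positivity
    rw [hdd]; nlinarith
  -- The matrix d(L K⁻¹ - D) is singular because L is an eigenvalue of DK; with a positive diagonal
  -- entry it is positive semidefinite.
  have hdet : (L * E - d * g) * (L * E - d * k) = (L * F) ^ 2 := by
    linear_combination d * hsq' + d ^ 2 * hgk + L ^ 2 * (-hdd)
  have hform : 0 ≤ (L * E - d * g) * X ^ 2 - 2 * (L * F) * (X * Y) + (L * E - d * k) * Y ^ 2 := by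
    refine le_of_mul_le_mul_left ?_ hα
    have : (L * E - d * g) * ((L * E - d * g) * X ^ 2 - 2 * (L * F) * (X * Y)
        + (L * E - d * k) * Y ^ 2) = ((L * E - d * g) * X - L * F * Y) ^ 2 := by
      linear_combination Y ^ 2 * hdet
    rw [this, mul_zero]
    positivity
  have hq : E * X ^ 2 - 2 * F * (X * Y) + E * Y ^ 2
      = d * (E * (x ^ 2 + y ^ 2) + 2 * F * (x * y)) := by
    rw [hX, hY, hdd]; ring
  -- This is ⟨Tu, u⟩ ≤ L⟨u, u⟩ in the form K, with (X, Y) = Ku.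
  have hmid : g * X ^ 2 + k * Y ^ 2 ≤ L * (E * (x ^ 2 + y ^ 2) + 2 * F * (x * y)) := by
    refine le_of_mul_le_mul_left ?_ hd
    linear_combination hform + L * hq
  have hτ : 0 ≤ E * (g + k) := by positivity
  -- Cayley–Hamilton: ⟨Tu, Tu⟩ = ⟨T²u, u⟩ = tr(T)⟨Tu, u⟩ - det(T)⟨u, u⟩.
  have hCH : E * ((g * X) ^ 2 + (k * Y) ^ 2) + 2 * F * (g * X * (k * Y))
      = E * (g + k) * (g * X ^ 2 + k * Y ^ 2)
        - d * (E * (x ^ 2 + y ^ 2) + 2 * F * (x * y)) := by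
    linear_combination (2 * F * (X * Y) - E * X ^ 2 - E * Y ^ 2) * hgk - hq
  rw [hCH, hsq']
  have := mul_le_mul_of_nonneg_left hmid hτ
  linarith

lemma transferForm_list_le {lam : ℝ} (hlam : 0 < lam) (l : List ℝ) (u : ℤˣ → ℝ) :
    transferForm lam ((l.map (transfer lam)).prod.mulVec u)
      ≤ ((l.map (perron lam)).prod) ^ 2 * transferForm lam u := by
  induction l with
  | nil => simp
  | cons a l ih =>
    rw [List.map_cons, List.map_cons, List.prod_cons, List.prod_cons, ← Matrix.mulVec_mulVec,
      mul_pow, mul_assoc]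
    exact (transferForm_mulVec_le hlam a _).trans
      (mul_le_mul_of_nonneg_left ih (by positivity))

/-- The prefactor in the bound of the trace by the largest eigenvalues. -/
def traceConst (lam : ℝ) : ℝ :=
  2 * √(Real.exp lam / (Real.exp lam - Real.exp (-lam)))

lemma traceConst_pos {lam : ℝ} (hlam : 0 < lam) : 0 < traceConst lam := by
  have hEF : 0 < Real.exp lam - Real.exp (-lam) := sub_pos.2 (Real.exp_lt_exp.2 (by linarith))
  have := Real.exp_pos lam
  unfold traceConst
  positivity

/-- The factor e^λ - e^{-λ} is the smallest eigenvalue of the form; this converts bounds on the form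
into bounds on matrix entries. -/
lemma sq_le_transferForm {lam : ℝ} (u : ℤˣ → ℝ) (a : ℤˣ) (hlam : 0 < lam) :
    (Real.exp lam - Real.exp (-lam)) * u a ^ 2 ≤ transferForm lam u := by
  have hEF : 0 < Real.exp lam - Real.exp (-lam) := sub_pos.2 (Real.exp_lt_exp.2 (by linarith))
  have hF := Real.exp_pos (-lam)
  have h1 : (Real.exp lam - Real.exp (-lam)) * (u 1 ^ 2 + u (-1) ^ 2) ≤ transferForm lam u := by
    rw [transferForm]
    nlinarith [mul_nonneg hF.le (sq_nonneg (u 1 + u (-1)))]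
  refine le_trans (mul_le_mul_of_nonneg_left ?_ hEF.le) h1
  rcases Int.units_eq_one_or a with rfl | rfl
  · linarith [sq_nonneg (u (-1))]
  · linarith [sq_nonneg (u 1)]

lemma transferForm_single (lam : ℝ) (a : ℤˣ) :
    transferForm lam (Pi.single a 1) = Real.exp lam := by
  have h1 : (1 : ℤˣ) ≠ -1 := by decide
  have h2 : (-1 : ℤˣ) ≠ 1 := by decide
  rcases Int.units_eq_one_or a with rfl | rfl <;> simp [transferForm, h1, h2]

lemma ringZ_le {lam : ℝ} (hlam : 0 < lam) {ℓ : ℕ} (hℓ : 1 ≤ ℓ) (h : Fin ℓ → ℝ) :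
    ringZ lam ℓ h ≤ traceConst lam * ∏ i, perron lam (h i) := by
  obtain ⟨n, rfl⟩ : ∃ n, ℓ = n + 1 := ⟨ℓ - 1, by omega⟩
  have hEF : 0 < Real.exp lam - Real.exp (-lam) := sub_pos.2 (Real.exp_lt_exp.2 (by linarith))
  have hE := Real.exp_pos lam
  have hlist : (List.ofFn fun i => transfer lam (h i)) = (List.ofFn h).map (transfer lam) := by
    rw [List.map_ofFn]; rfl
  have hprod : ((List.ofFn h).map (perron lam)).prod = ∏ i, perron lam (h i) := by
    rw [List.map_ofFn, List.prod_ofFn]; rfl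
  have hpos : 0 < ∏ i, perron lam (h i) := Finset.prod_pos fun i _ => perron_pos lam (h i)
  set T := ((List.ofFn h).map (transfer lam)).prod with hT
  have hentry : ∀ a, T a a ≤ √(Real.exp lam / (Real.exp lam - Real.exp (-lam)))
      * ∏ i, perron lam (h i) := by
    intro a
    have h1 := transferForm_list_le hlam (List.ofFn h) (Pi.single a 1)
    have h2 := sq_le_transferForm (T.mulVec (Pi.single a 1)) a hlam
    rw [← hT, hprod, transferForm_single] at h1
    have h3 : T.mulVec (Pi.single a 1) a = T a a := by simp
    rw [h3] at h2
    refine abs_le_of_sq_le_sq' ?_ (by positivity) |>.2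
    rw [mul_pow, Real.sq_sqrt (by positivity), div_mul_eq_mul_div, le_div_iff₀ hEF]
    linarith
  rw [ringZ_eq_trace, hlist, ← hT, Matrix.trace, sum_units_int, traceConst]
  simp only [Matrix.diag_apply]
  linarith [hentry 1, hentry (-1)]

/-- Cayley–Hamilton; it gives the traces of powers a two-term recursion without diagonalizing. -/
lemma transfer_sq (lam h : ℝ) : transfer lam h ^ 2
    = (2 * Real.exp lam * Real.cosh h) • transfer lam h
      - (Real.exp lam ^ 2 - Real.exp (-lam) ^ 2) • (1 : Matrix ℤˣ ℤˣ ℝ) := by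
  have hgk : Real.exp h * Real.exp (-h) = 1 := by rw [← Real.exp_add]; simp
  have hcosh : 2 * Real.cosh h = Real.exp h + Real.exp (-h) := by rw [Real.cosh_eq]; ring
  have h1 : (1 : ℤˣ) ≠ -1 := by decide
  have h2 : (-1 : ℤˣ) ≠ 1 := by decide
  have hc : 2 * Real.exp lam * Real.cosh h = Real.exp lam * (Real.exp h + Real.exp (-h)) := by
    rw [← hcosh]; ring
  rw [hc]
  ext a b
  rw [pow_two, Matrix.mul_apply, sum_units_int]
  rcases Int.units_eq_one_or a with rfl | rfl <;> rcases Int.units_eq_one_or b with rfl | rfl <;>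
    simp [transfer, spin_one, spin_neg_one, Real.exp_add, h1, h2]
  · linear_combination (Real.exp (-lam) ^ 2 - Real.exp lam ^ 2) * hgk
  · ring
  · ring
  · linear_combination (Real.exp (-lam) ^ 2 - Real.exp lam ^ 2) * hgk

lemma trace_transfer_pow (lam h : ℝ) (n : ℕ) :
    (transfer lam h ^ n).trace
      = perron lam h ^ n + (2 * Real.exp lam * Real.cosh h - perron lam h) ^ n := by
  induction n using Nat.twoStepInduction with
  | zero => simp [Matrix.trace]; norm_num
  | one =>
    have hcosh : 2 * Real.cosh h = Real.exp h + Real.exp (-h) := by rw [Real.cosh_eq]; ring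
    simp [Matrix.trace, transfer, spin_one, spin_neg_one, Real.exp_add]
    linear_combination -Real.exp lam * hcosh
  | more n ih1 ih2 =>
    rw [pow_add, transfer_sq, mul_sub, Matrix.mul_smul, Matrix.mul_smul, mul_one, ← pow_succ,
      Matrix.trace_sub, Matrix.trace_smul, Matrix.trace_smul, ih1, ih2]
    have := perron_sq lam h
    simp only [smul_eq_mul]
    generalize perron lam h = L at *
    linear_combination (-L ^ n - (2 * Real.exp lam * Real.cosh h - L) ^ n) * this

lemma perron_pow_le_ringZ {lam : ℝ} (hlam : 0 < lam) {ℓ : ℕ} (hℓ : 1 ≤ ℓ) (h : ℝ) :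
    perron lam h ^ ℓ ≤ ringZ lam ℓ fun _ => h := by
  obtain ⟨n, rfl⟩ : ∃ n, ℓ = n + 1 := ⟨ℓ - 1, by omega⟩
  have hEF : Real.exp (-lam) < Real.exp lam := Real.exp_lt_exp.2 (by linarith)
  have hF := Real.exp_pos (-lam)
  rw [ringZ_eq_trace, List.ofFn_const, List.prod_replicate, trace_transfer_pow]
  -- The second eigenvalue is nonnegative because e^{2λ} > e^{-2λ} makes the determinant positive,
  -- so dropping its power is allowed for every ℓ.
  have h0 : 0 ≤ 2 * Real.exp lam * Real.cosh h - perron lam h := by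
    have hs := sqrt_perron_sq lam h
    have hc := Real.cosh_sq h
    have : √(Real.exp (2 * lam) * Real.sinh h ^ 2 + Real.exp (-(2 * lam)))
        ≤ Real.exp lam * Real.cosh h := by
      refine abs_le_of_sq_le_sq' ?_ (by have := Real.cosh_pos h; positivity) |>.2
      rw [hs, mul_pow, hc]
      nlinarith
    rw [perron]
    linarith
  have := pow_nonneg h0 (n + 1)
  linarith


/-! ### The one-variable pressure functional and the location of its maximizer. -/

lemma deriv_entropy {m : ℝ} (hm : m ∈ Set.Ioo (-1 : ℝ) 1) :
    deriv entropy m = -Real.artanh m := by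
  have h1 : 0 < (1 + m) / 2 := by linarith [hm.1]
  have h2 : 0 < (1 - m) / 2 := by linarith [hm.2]
  have d1 : HasDerivAt (fun x : ℝ => (1 + x) / 2) (1 / 2) m :=
    ((hasDerivAt_id m).const_add 1).div_const 2
  have d2 : HasDerivAt (fun x : ℝ => (1 - x) / 2) (-1 / 2) m :=
    ((hasDerivAt_id m).const_sub 1).div_const 2
  have d : HasDerivAt entropy _ m :=
    ((d1.mul (d1.log h1.ne')).add (d2.mul (d2.log h2.ne'))).neg
  rw [d.deriv, Real.artanh_eq_half_log ⟨hm.1.le, hm.2.le⟩,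
    show (1 + m) / (1 - m) = ((1 + m) / 2) / ((1 - m) / 2) by field_simp,
    Real.log_div h1.ne' h2.ne']
  have e1 : (1 + m) / 2 * (1 / 2 / ((1 + m) / 2)) = 1 / 2 := mul_div_cancel₀ _ h1.ne'
  have e2 : (1 - m) / 2 * (-1 / 2 / ((1 - m) / 2)) = -1 / 2 := mul_div_cancel₀ _ h2.ne'
  rw [e1, e2]
  ring

lemma hasDerivAt_tanh (x : ℝ) : HasDerivAt Real.tanh (1 / Real.cosh x ^ 2) x := by
  have hc := Real.cosh_pos x
  have h := (Real.hasDerivAt_sinh x).div (Real.hasDerivAt_cosh x) hc.ne'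
  have hfun : Real.tanh = Real.sinh / Real.cosh := by
    funext y; exact Real.tanh_eq_sinh_div_cosh y
  rw [hfun]
  rwa [show Real.cosh x * Real.cosh x - Real.sinh x * Real.sinh x = 1 by
    linear_combination Real.cosh_sq x] at h

lemma strictMonoOn_sub_tanh : StrictMonoOn (fun x => x - Real.tanh x) (Set.Ici 0) := by
  have hd : ∀ x, HasDerivAt (fun x => x - Real.tanh x) (1 - 1 / Real.cosh x ^ 2) x :=
    fun x => (hasDerivAt_id x).sub (hasDerivAt_tanh x)
  refine strictMonoOn_of_deriv_pos (convex_Ici 0)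
    (fun x _ => (hd x).continuousAt.continuousWithinAt) fun x hx => ?_
  rw [interior_Ici] at hx
  have hc : 1 < Real.cosh x := Real.one_lt_cosh.2 (ne_of_gt hx)
  rw [(hd x).deriv, sub_pos, div_lt_one (by positivity)]
  nlinarith

lemma hasDerivAt_log_perron (lam h : ℝ) :
    HasDerivAt (fun h => Real.log (perron lam h))
      (Real.exp lam * Real.sinh h
        / √(Real.exp (2 * lam) * Real.sinh h ^ 2 + Real.exp (-(2 * lam)))) h := by
  have hp : 0 < Real.exp (2 * lam) * Real.sinh h ^ 2 + Real.exp (-(2 * lam)) := by positivity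
  have hR : 0 < √(Real.exp (2 * lam) * Real.sinh h ^ 2 + Real.exp (-(2 * lam))) :=
    Real.sqrt_pos.2 hp
  have hL := perron_pos lam h
  have d1 := ((((Real.hasDerivAt_sinh h).pow 2).const_mul (Real.exp (2 * lam))).add_const
    (Real.exp (-(2 * lam)))).sqrt hp.ne'
  have d2 : HasDerivAt (perron lam) _ h :=
    ((Real.hasDerivAt_cosh h).const_mul (Real.exp lam)).add d1
  convert d2.log hL.ne' using 1
  rw [eq_div_iff hL.ne']
  unfold perron
  simp only [Pi.pow_apply]
  generalize √(Real.exp (2 * lam) * Real.sinh h ^ 2 + Real.exp (-(2 * lam))) = R at *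
  rw [exp_two_mul]
  field_simp
  norm_num
  ring

/-- The square root is at least e^{-λ} cosh h, so the quotient is at most e^{2λ} tanh h: a small
perturbation of the free magnetization. -/
lemma deriv_log_perron_le {lam h : ℝ} (hlam : 0 < lam) (hh : 0 ≤ h) :
    Real.exp lam * Real.sinh h
        / √(Real.exp (2 * lam) * Real.sinh h ^ 2 + Real.exp (-(2 * lam)))
      ≤ Real.tanh h + (Real.exp (2 * lam) - 1) := by
  have hc := Real.cosh_pos h
  have hs := Real.sinh_nonneg_iff.2 hh
  have hF := Real.exp_pos (-lam)
  have hE := Real.exp_pos lam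
  have hEF : Real.exp lam * Real.exp (-lam) = 1 := by rw [← Real.exp_add]; simp
  have hFE : Real.exp (-lam) < Real.exp lam := Real.exp_lt_exp.2 (by linarith)
  have h1 : Real.exp (-lam) * Real.cosh h ≤
      √(Real.exp (2 * lam) * Real.sinh h ^ 2 + Real.exp (-(2 * lam))) := by
    refine Real.le_sqrt_of_sq_le ?_
    rw [mul_pow, Real.cosh_sq, exp_two_mul, ← mul_neg, exp_two_mul]
    have : Real.exp (-lam) ^ 2 ≤ Real.exp lam ^ 2 := by gcongr
    nlinarith [mul_le_mul_of_nonneg_right this (sq_nonneg (Real.sinh h))]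
  have h2 : Real.exp lam * Real.sinh h
        / √(Real.exp (2 * lam) * Real.sinh h ^ 2 + Real.exp (-(2 * lam)))
      ≤ Real.exp lam * Real.sinh h / (Real.exp (-lam) * Real.cosh h) :=
    div_le_div_of_nonneg_left (by positivity) (by positivity) h1
  have h3 : Real.exp lam * Real.sinh h / (Real.exp (-lam) * Real.cosh h)
      = Real.exp (2 * lam) * Real.tanh h := by
    rw [Real.tanh_eq_sinh_div_cosh, exp_two_mul]
    field_simp
    linear_combination -Real.sinh h * hEF
  have h4 : 1 ≤ Real.exp (2 * lam) := Real.one_le_exp (by linarith)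
  rw [h3] at h2
  nlinarith [Real.tanh_lt_one h]

/-- The mean-field pressure functional is maximized on `[-1, 1]` at a point whose total field is
bounded by `a`. -/
lemma exists_max_pressure {lam hext hstar a : ℝ} (hlam : 0 < lam) (hext_mem : hext ∈ Set.Icc 0 hstar)
    (ha0 : 0 ≤ a) (ha : hstar + (Real.exp (2 * lam) - 1) < a - Real.tanh a) :
    ∃ t₀ ∈ Set.Icc (-1 : ℝ) 1, t₀ + hext ≤ a ∧ ∀ t ∈ Set.Icc (-1 : ℝ) 1,
      Real.log (perron lam (t + hext)) - t ^ 2 / 2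
        ≤ Real.log (perron lam (t₀ + hext)) - t₀ ^ 2 / 2 := by
  have hd : ∀ t, HasDerivAt (fun t => Real.log (perron lam (t + hext)) - t ^ 2 / 2)
      (Real.exp lam * Real.sinh (t + hext)
        / √(Real.exp (2 * lam) * Real.sinh (t + hext) ^ 2 + Real.exp (-(2 * lam))) - t) t := by
    intro t
    have d1 := (hasDerivAt_log_perron lam (t + hext)).comp_add_const t hext
    have d2 : HasDerivAt (fun t : ℝ => t ^ 2 / 2) t t := by
      simpa using (hasDerivAt_pow 2 t).div_const 2
    exact d1.sub d2
  have hcont : Continuous fun t => Real.log (perron lam (t + hext)) - t ^ 2 / 2 :=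
    continuous_iff_continuousAt.2 fun t => (hd t).continuousAt
  obtain ⟨t₀, ht₀, hmax⟩ := (isCompact_Icc (a := (-1 : ℝ)) (b := 1)).exists_isMaxOn
    ⟨0, by norm_num⟩ hcont.continuousOn
  refine ⟨t₀, ht₀, ?_, fun t ht => hmax ht⟩
  by_contra! hlt
  have h4 : 1 ≤ Real.exp (2 * lam) := Real.one_le_exp (by linarith)
  -- For x = t + hext ≥ a the slope is at most hext + (e^{2λ} - 1) - (x - tanh x) < 0, since x -
  -- tanh x increases; a maximizer beyond a - hext would thus be beaten there.
  have hanti : StrictAntiOn (fun t => Real.log (perron lam (t + hext)) - t ^ 2 / 2)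
      (Set.Icc (a - hext) t₀) := by
    refine strictAntiOn_of_deriv_neg (convex_Icc _ _) hcont.continuousOn fun t ht => ?_
    rw [interior_Icc] at ht
    have hta : a ≤ t + hext := by linarith [ht.1]
    have h1 := deriv_log_perron_le hlam (ha0.trans hta)
    have h2 := strictMonoOn_sub_tanh.monotoneOn (Set.mem_Ici.2 ha0)
      (Set.mem_Ici.2 (ha0.trans hta)) hta
    rw [(hd t).deriv]
    linarith [hext_mem.2]
  have hat : a - hext ∈ Set.Icc (-1 : ℝ) 1 := by
    have h5 := strictMonoOn_sub_tanh.monotoneOn (Set.mem_Ici.2 le_rfl) (Set.mem_Ici.2 ha0) ha0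
    have h6 := Real.neg_one_lt_tanh a
    exact ⟨by linarith [hext_mem.2], by linarith [ht₀.2]⟩
  have := hanti (Set.left_mem_Icc.2 (by linarith)) (Set.right_mem_Icc.2 (by linarith))
    (by linarith : a - hext < t₀)
  exact absurd (hmax hat) (not_le.2 this)

/-- A field strictly above the mean-field critical one whose free magnetization is still below
`mplus`. -/
lemma exists_field_threshold {hstar mstar mplus : ℝ} (hm : mstar ∈ Set.Ioo (0 : ℝ) 1)
    (heq : -(deriv entropy mstar + mstar) = hstar) (hp : mplus ∈ Set.Ioo mstar 1) :
    ∃ a, hstar < a ∧ hstar < a - Real.tanh a ∧ Real.tanh a < mplus := by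
  have hm' : mstar ∈ Set.Ioo (-1 : ℝ) 1 := ⟨by linarith [hm.1], hm.2⟩
  -- With a* = artanh m*, the equation reads a* - tanh a* = h*; moving to m strictly between m* and
  -- m₊ makes both required inequalities strict.
  rw [deriv_entropy hm'] at heq
  obtain ⟨m, hm1, hm2⟩ := exists_between hp.1
  have hmm : m ∈ Set.Ioo (-1 : ℝ) 1 := ⟨by linarith [hm.1], hm2.trans hp.2⟩
  have hlt : Real.artanh mstar < Real.artanh m :=
    Real.artanh_lt_artanh hm'.1 hmm.2 hm1
  have h0 := Real.artanh_pos hm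
  refine ⟨Real.artanh m, by linarith [hm.1], ?_, by rwa [Real.tanh_artanh hmm]⟩
  have := strictMonoOn_sub_tanh (Set.mem_Ici.2 h0.le) (Set.mem_Ici.2 (h0.trans hlt).le) hlt
  simp only [Real.tanh_artanh hm'] at this
  linarith


/-! ### Independent columns and the upper bound for the canonical sum. -/

/-- The weight of a configuration of independent columns, each an Ising ring in the field `h`. -/
def columnsWeight (lam : ℝ) (ℓ : ℕ) (h : Fin ℓ → ℝ) (σ : Fin ℓ → Fin ℓ → ℤˣ) : ℝ :=
  ∏ x, gibbsWeight lam ℓ h (σ x)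

lemma columnsWeight_pos (lam : ℝ) (ℓ : ℕ) (h : Fin ℓ → ℝ) (σ : Fin ℓ → Fin ℓ → ℤˣ) :
    0 < columnsWeight lam ℓ h σ :=
  Finset.prod_pos fun x _ => gibbsWeight_pos lam ℓ h (σ x)

lemma sum_columnsWeight (lam : ℝ) (ℓ : ℕ) (h : Fin ℓ → ℝ) :
    ∑ σ, columnsWeight lam ℓ h σ = ringZ lam ℓ h ^ ℓ := by
  rw [ringZ_eq_sum, Fintype.sum_pow]
  rfl

lemma columnsWeight_eq (lam : ℝ) (ℓ : ℕ) (h : Fin ℓ → ℝ) (σ : Fin ℓ → Fin ℓ → ℤˣ) :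
    columnsWeight lam ℓ h σ
      = Real.exp (-vertEnergy lam ℓ σ) * Real.exp (∑ i, h i * ∑ x, spin (σ x i)) := by
  rw [columnsWeight, vertEnergy, ← Real.exp_add]
  simp_rw [gibbsWeight]
  rw [← Real.exp_sum, ← Finset.sum_neg_distrib]
  congr 1
  simp_rw [Finset.mul_sum, Finset.sum_add_distrib]
  congr 1
  · refine Finset.sum_congr rfl fun x _ => ?_
    rw [← Finset.sum_neg_distrib]
    exact Finset.sum_congr rfl fun i _ => by ring
  · exact Finset.sum_comm

lemma columnsWeight_add_single (lam : ℝ) (ℓ : ℕ) (h : Fin ℓ → ℝ) (i : Fin ℓ) (t : ℝ)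
    (σ : Fin ℓ → Fin ℓ → ℤˣ) :
    columnsWeight lam ℓ (h + Pi.single i t) σ
      = columnsWeight lam ℓ h σ * Real.exp (t * ∑ x, spin (σ x i)) := by
  simp_rw [columnsWeight, gibbsWeight_add_single]
  rw [Finset.prod_mul_distrib, ← Real.exp_sum, Finset.mul_sum]

/-- On configurations with layer magnetizations m the field factor is constant, so the left side is
part of the sum of positive weights that makes up Z^ℓ. -/
lemma multiCanonicalZ_mul_exp_le (lam : ℝ) (ℓ : ℕ) (h m : Fin ℓ → ℝ) :
    multiCanonicalZ lam ℓ m * Real.exp (ℓ * ∑ i, h i * m i) ≤ ringZ lam ℓ h ^ ℓ := by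
  rw [← sum_columnsWeight, multiCanonicalZ, Finset.sum_mul]
  refine Finset.sum_le_sum fun σ _ => ?_
  split_ifs with hσ
  · rw [columnsWeight_eq, Finset.mul_sum]
    refine le_of_eq ?_
    congr 2
    exact Finset.sum_congr rfl fun i _ => by rw [hσ i]; ring
  · rw [zero_mul]
    exact (columnsWeight_pos ..).le

/-- The number of positive spins in each layer. -/
def plusCount {ℓ : ℕ} (σ : Fin ℓ → Fin ℓ → ℤˣ) (i : Fin ℓ) : Fin (ℓ + 1) :=
  ⟨(Finset.univ.filter fun x => σ x i = 1).card,
    Nat.lt_succ_of_le ((Finset.card_le_univ _).trans_eq (Fintype.card_fin ℓ))⟩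

lemma sum_spin_eq {ℓ : ℕ} (σ : Fin ℓ → Fin ℓ → ℤˣ) (i : Fin ℓ) :
    ∑ x, spin (σ x i) = 2 * ((plusCount σ i : ℕ) : ℝ) - ℓ := by
  have h1 : ∀ x, spin (σ x i) = 2 * (if σ x i = 1 then 1 else 0) - 1 := by
    intro x
    rcases Int.units_eq_one_or (σ x i) with h | h <;> rw [h]
    · rw [spin_one, if_pos rfl]; norm_num
    · rw [spin_neg_one, if_neg (by decide)]; norm_num
  simp_rw [h1]
  rw [Finset.sum_sub_distrib, ← Finset.mul_sum, Finset.sum_boole]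
  simp [plusCount]

lemma multiCanonicalZ_pos (lam : ℝ) {ℓ : ℕ} (hℓ : 1 ≤ ℓ) {m : Fin ℓ → ℝ}
    (hm : ∀ i, m i ∈ magValues ℓ) : 0 < multiCanonicalZ lam ℓ m := by
  have hℓ' : (ℓ : ℝ) ≠ 0 := by positivity
  choose k hk hmk using hm
  have hS : ∀ i, ∃ S : Finset (Fin ℓ), S.card = k i := fun i => by
    obtain ⟨S, _, hS⟩ := Finset.exists_subset_card_eq
      (s := (Finset.univ : Finset (Fin ℓ))) (n := k i) (by simpa using hk i)
    exact ⟨S, hS⟩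
  choose S hS using hS
  set σ : Fin ℓ → Fin ℓ → ℤˣ := fun x i => if x ∈ S i then 1 else -1 with hσ
  have hσm : ∀ i, ∑ x, spin (σ x i) = (ℓ : ℝ) * m i := by
    intro i
    have hf : (Finset.univ.filter fun x => σ x i = 1) = S i := by
      ext x
      by_cases hx : x ∈ S i
      · simp [hσ, hx]
      · simp [hσ, hx]
    rw [sum_spin_eq, plusCount, hmk i]
    simp only [hf, hS]
    field_simp
    ring
  refine Finset.sum_pos' (fun τ _ => ?_) ⟨σ, Finset.mem_univ _, ?_⟩
  · split_ifs
    · exact (Real.exp_pos _).le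
    · exact le_rfl
  · rw [if_pos hσm]
    exact Real.exp_pos _

/-- The exponent maximized in the definition of `logZmax`. -/
def canonicalFunctional (lam hext : ℝ) (ℓ : ℕ) (m : Fin ℓ → ℝ) : ℝ :=
  ∑ _x : Fin ℓ, ∑ i : Fin ℓ, (m i ^ 2 / 2 + hext * m i - multiCanonicalPhi lam ℓ m)

lemma canonicalFunctional_eq (lam hext : ℝ) {ℓ : ℕ} (hℓ : 1 ≤ ℓ) (m : Fin ℓ → ℝ) :
    canonicalFunctional lam hext ℓ m
      = ℓ * ∑ i, (m i ^ 2 / 2 + hext * m i) + Real.log (multiCanonicalZ lam ℓ m) := by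
  have hℓ' : (ℓ : ℝ) ≠ 0 := by positivity
  rw [canonicalFunctional, Finset.sum_const, Finset.sum_sub_distrib, Finset.sum_const,
    multiCanonicalPhi]
  simp only [Finset.card_univ, Fintype.card_fin, nsmul_eq_mul]
  field_simp
  ring

lemma mem_Icc_of_mem_magValues {ℓ : ℕ} (hℓ : 1 ≤ ℓ) {m : ℝ} (hm : m ∈ magValues ℓ) :
    m ∈ Set.Icc (-1 : ℝ) 1 := by
  obtain ⟨k, hk, rfl⟩ := hm
  have hℓ' : (0 : ℝ) < ℓ := by positivity
  have h1 : 0 ≤ (k : ℝ) / ℓ := by positivity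
  have h2 : (k : ℝ) / ℓ ≤ 1 := by
    rw [div_le_one hℓ']; exact_mod_cast hk
  constructor <;> rw [mul_div_assoc] <;> linarith

lemma log_ringZ_le {lam hext P : ℝ} (hlam : 0 < lam) {ℓ : ℕ} (hℓ : 1 ≤ ℓ)
    (hP : ∀ t ∈ Set.Icc (-1 : ℝ) 1, Real.log (perron lam (t + hext)) - t ^ 2 / 2 ≤ P)
    {m : Fin ℓ → ℝ} (hm : ∀ i, m i ∈ Set.Icc (-1 : ℝ) 1) :
    Real.log (ringZ lam ℓ fun i => m i + hext) - ∑ i, m i ^ 2 / 2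
      ≤ Real.log (traceConst lam) + ℓ * P := by
  have h1 := Real.log_le_log (ringZ_pos ..) (ringZ_le hlam hℓ fun i => m i + hext)
  rw [Real.log_mul (traceConst_pos hlam).ne' (Finset.prod_pos fun i _ => perron_pos ..).ne',
    Real.log_prod fun i _ => (perron_pos ..).ne'] at h1
  have h2 := Finset.sum_le_sum fun i (_ : i ∈ Finset.univ) => hP (m i) (hm i)
  rw [Finset.sum_sub_distrib] at h2
  simp only [Finset.sum_const, Finset.card_univ, Fintype.card_fin, nsmul_eq_mul] at h2
  linarith

/-- The field m_i + hext depends on m itself; it turns m²/2 + hext m - (m + hext)m into -m²/2. -/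
lemma canonicalFunctional_le {lam hext P : ℝ} (hlam : 0 < lam) {ℓ : ℕ} (hℓ : 1 ≤ ℓ)
    (hP : ∀ t ∈ Set.Icc (-1 : ℝ) 1, Real.log (perron lam (t + hext)) - t ^ 2 / 2 ≤ P)
    {m : Fin ℓ → ℝ} (hm : ∀ i, m i ∈ magValues ℓ) :
    canonicalFunctional lam hext ℓ m ≤ ℓ * (Real.log (traceConst lam) + ℓ * P) := by
  have hZ := multiCanonicalZ_pos lam hℓ hm
  have h1 := Real.log_le_log (mul_pos hZ (Real.exp_pos _))
    (multiCanonicalZ_mul_exp_le lam ℓ (fun i => m i + hext) m)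
  rw [Real.log_mul hZ.ne' (Real.exp_pos _).ne', Real.log_exp, Real.log_pow] at h1
  have h2 := log_ringZ_le hlam hℓ hP fun i => mem_Icc_of_mem_magValues hℓ (hm i)
  have h3 := mul_le_mul_of_nonneg_left h2 (Nat.cast_nonneg (α := ℝ) ℓ)
  have h4 : ∑ i, (m i + hext) * m i = ∑ i, (m i ^ 2 / 2 + hext * m i) + ∑ i, m i ^ 2 / 2 := by
    rw [← Finset.sum_add_distrib]
    exact Finset.sum_congr rfl fun i _ => by ring
  rw [h4] at h1
  rw [canonicalFunctional_eq lam hext hℓ]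
  linarith

/-! ### Concentration of layer magnetizations and counting. -/

/-- A ±1 spin satisfies e^{tσ} = cosh t + σ sinh t, so its moment generating function depends on its
mean alone. -/
lemma ringZ_add_single (lam : ℝ) (ℓ : ℕ) (h : Fin ℓ → ℝ) (i : Fin ℓ) (t : ℝ) :
    ringZ lam ℓ (h + Pi.single i t)
      = ringZ lam ℓ h * (Real.cosh t + mag lam ℓ h i * Real.sinh t) := by
  have he : ∀ s : Fin ℓ → ℤˣ, Real.exp (t * spin (s i))
      = Real.cosh t + spin (s i) * Real.sinh t := by
    intro s
    rcases spin_eq_or (s i) with h | h <;> rw [h]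
    · rw [mul_one, one_mul, Real.cosh_add_sinh]
    · rw [mul_neg, mul_one, neg_mul, one_mul, ← sub_eq_add_neg, Real.cosh_sub_sinh]
  rw [mul_add, ← mul_assoc, mul_comm (ringZ lam ℓ h) (mag lam ℓ h i), mag_mul_ringZ, ringZ_eq_sum,
    ringZ_eq_sum, Finset.sum_mul, Finset.sum_mul, ← Finset.sum_add_distrib]
  refine Finset.sum_congr rfl fun s _ => ?_
  rw [gibbsWeight_add_single, he]
  ring

/-- Both sides equal 1 at s = 0, with slopes m < m'; this makes the Chernoff rate nontrivial. -/
lemma exists_cosh_add_lt_exp {m m' : ℝ} (h : m < m') :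
    ∃ s : ℝ, 0 < s ∧ Real.cosh s + m * Real.sinh s < Real.exp (s * m') := by
  have hd : HasDerivAt (fun s => Real.exp (s * m') - (Real.cosh s + m * Real.sinh s))
      (m' - m) 0 := by
    have d1 : HasDerivAt (fun s : ℝ => Real.exp (s * m')) m' 0 := by
      simpa using ((hasDerivAt_id (0 : ℝ)).mul_const m').exp
    have d2 : HasDerivAt (fun s => Real.cosh s + m * Real.sinh s) m 0 := by
      simpa using (Real.hasDerivAt_cosh 0).fun_add ((Real.hasDerivAt_sinh 0).const_mul m)
    exact d1.sub d2
  have ht := hd.tendsto_slope_zero_right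
  obtain ⟨s, hs, hs0⟩ := ((ht.eventually (lt_mem_nhds (sub_pos.2 h))).and
    self_mem_nhdsWithin).exists
  refine ⟨s, hs0, ?_⟩
  have hs0' : (0 : ℝ) < s := hs0
  simp only [zero_add, zero_mul, Real.exp_zero, Real.cosh_zero, Real.sinh_zero, mul_zero, add_zero,
    sub_self, sub_zero, smul_eq_mul] at hs
  exact sub_pos.1 (pos_of_mul_pos_right hs (inv_pos.2 hs0').le)

open Classical in
/-- Chernoff's bound: the columns have layer magnetizations bounded by `mplus` with probability
close to one. -/
lemma ringZ_pow_mul_le_sum {lam mplus m s : ℝ} (hs : 0 < s) {ℓ : ℕ} {h : Fin ℓ → ℝ}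
    (hm : ∀ i, |mag lam ℓ h i| ≤ m) :
    ringZ lam ℓ h ^ ℓ
        * (1 - 2 * (ℓ * ((Real.cosh s + m * Real.sinh s) / Real.exp (s * mplus)) ^ ℓ))
      ≤ ∑ σ, if ∀ i, |∑ x, spin (σ x i)| ≤ ℓ * mplus then columnsWeight lam ℓ h σ else 0 := by
  have hZ := ringZ_pos lam ℓ h
  have hsinh : 0 < Real.sinh s := Real.sinh_pos_iff.2 hs
  -- Union bound over layers and both tails: a violation in layer i makes one of the weights tilted
  -- by ±s there, times e^{-ℓsm₊}, at least the original weight.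
  have hpt : ∀ σ : Fin ℓ → Fin ℓ → ℤˣ, columnsWeight lam ℓ h σ ≤
      (if ∀ i, |∑ x, spin (σ x i)| ≤ ℓ * mplus then columnsWeight lam ℓ h σ else 0)
      + ∑ i, (columnsWeight lam ℓ (h + Pi.single i s) σ
          + columnsWeight lam ℓ (h + Pi.single i (-s)) σ) * Real.exp (-(ℓ * (s * mplus))) := by
    intro σ
    have hW := columnsWeight_pos lam ℓ h σ
    have hnn : ∀ i, 0 ≤ (columnsWeight lam ℓ (h + Pi.single i s) σ
          + columnsWeight lam ℓ (h + Pi.single i (-s)) σ) * Real.exp (-(ℓ * (s * mplus))) :=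
      fun i => mul_nonneg (add_pos (columnsWeight_pos ..) (columnsWeight_pos ..)).le
        (Real.exp_pos _).le
    split_ifs with hσ
    · linarith [Finset.sum_nonneg fun i (_ : i ∈ Finset.univ) => hnn i]
    · push Not at hσ
      obtain ⟨i, hi⟩ := hσ
      rw [zero_add]
      refine le_trans ?_ (Finset.single_le_sum (fun i _ => hnn i) (Finset.mem_univ i))
      rw [columnsWeight_add_single, columnsWeight_add_single, ← mul_add, mul_assoc, add_mul,
        ← Real.exp_add, ← Real.exp_add]
      refine le_mul_of_one_le_right hW.le ?_
      rcases lt_abs.1 hi with h1 | h1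
      · have : 1 ≤ Real.exp (s * ∑ x, spin (σ x i) + -(ℓ * (s * mplus))) :=
          Real.one_le_exp (by nlinarith)
        linarith [Real.exp_pos (-s * ∑ x, spin (σ x i) + -(ℓ * (s * mplus)))]
      · have : 1 ≤ Real.exp (-s * ∑ x, spin (σ x i) + -(ℓ * (s * mplus))) :=
          Real.one_le_exp (by nlinarith)
        linarith [Real.exp_pos (s * ∑ x, spin (σ x i) + -(ℓ * (s * mplus)))]
  have hsum := Finset.sum_le_sum fun σ (_ : σ ∈ Finset.univ) => hpt σ
  rw [Finset.sum_add_distrib, sum_columnsWeight, Finset.sum_comm] at hsum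
  simp_rw [← Finset.sum_mul, Finset.sum_add_distrib, sum_columnsWeight, ringZ_add_single,
    Real.cosh_neg, Real.sinh_neg] at hsum
  have hbound : ∀ i, (ringZ lam ℓ h * (Real.cosh s + mag lam ℓ h i * Real.sinh s)) ^ ℓ
      ≤ ringZ lam ℓ h ^ ℓ * (Real.cosh s + m * Real.sinh s) ^ ℓ := by
    intro i
    rw [← mul_pow]
    have h1 := (mag_mem lam ℓ h i).1
    have h2 := (abs_le.1 (hm i)).2
    have h3 : 0 ≤ Real.cosh s + mag lam ℓ h i * Real.sinh s := by
      nlinarith [Real.sinh_lt_cosh s]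
    gcongr
  have hbound' : ∀ i, (ringZ lam ℓ h * (Real.cosh s + mag lam ℓ h i * -Real.sinh s)) ^ ℓ
      ≤ ringZ lam ℓ h ^ ℓ * (Real.cosh s + m * Real.sinh s) ^ ℓ := by
    intro i
    rw [← mul_pow]
    have h1 := (mag_mem lam ℓ h i).2
    have h2 := (abs_le.1 (hm i)).1
    have h3 : 0 ≤ Real.cosh s + mag lam ℓ h i * -Real.sinh s := by
      nlinarith [Real.sinh_lt_cosh s]
    have h4 : Real.cosh s + mag lam ℓ h i * -Real.sinh s ≤ Real.cosh s + m * Real.sinh s := by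
      nlinarith
    gcongr
  have hall := mul_le_mul_of_nonneg_right
    (Finset.sum_le_sum fun i (_ : i ∈ Finset.univ) => add_le_add (hbound i) (hbound' i))
    (Real.exp_pos (-(ℓ * (s * mplus)))).le
  have hexp : Real.exp (-(ℓ * (s * mplus))) = (Real.exp (s * mplus) ^ ℓ)⁻¹ := by
    rw [Real.exp_neg, ← Real.exp_nat_mul]
  rw [Finset.sum_add_distrib] at hall
  simp only [Finset.sum_const, Finset.card_univ, Fintype.card_fin, nsmul_eq_mul] at hall
  rw [div_pow, div_eq_mul_inv, ← hexp]
  linarith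

open Classical in
/-- There are at most `(ℓ + 1) ^ ℓ` possible vectors of layer magnetizations. -/
lemma sum_columnsWeight_le {lam mplus B : ℝ} (hB : 0 ≤ B) {ℓ : ℕ} (hℓ : 1 ≤ ℓ) {h : Fin ℓ → ℝ}
    (hm : ∀ m ∈ admissibleMag mplus ℓ,
      multiCanonicalZ lam ℓ m * Real.exp (ℓ * ∑ i, h i * m i) ≤ B) :
    (∑ σ, if ∀ i, |∑ x, spin (σ x i)| ≤ ℓ * mplus then columnsWeight lam ℓ h σ else 0)
      ≤ ((ℓ : ℝ) + 1) ^ ℓ * B := by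
  have hℓ' : (0 : ℝ) < ℓ := by positivity
  -- Each fibre has a fixed magnetization vector; it contributes at most B if the vector is
  -- admissible and 0 otherwise.
  rw [← Finset.sum_fiberwise (s := Finset.univ) (g := fun σ => plusCount σ)]
  have hcard : ((ℓ : ℝ) + 1) ^ ℓ * B = ∑ _k : Fin ℓ → Fin (ℓ + 1), B := by
    simp
  rw [hcard]
  refine Finset.sum_le_sum fun k _ => ?_
  set m : Fin ℓ → ℝ := fun i => -1 + 2 * ((k i : ℕ) : ℝ) / ℓ with hmdef
  have hspin : ∀ σ : Fin ℓ → Fin ℓ → ℤˣ, plusCount σ = k →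
      ∀ i, ∑ x, spin (σ x i) = ℓ * m i := by
    rintro σ rfl i
    rw [sum_spin_eq, hmdef]
    field_simp
    ring
  by_cases hadm : ∀ i, |m i| ≤ mplus
  · refine le_trans ?_ (hm m fun i => ⟨⟨k i, Nat.lt_succ_iff.1 (k i).2, rfl⟩, hadm i⟩)
    rw [multiCanonicalZ, Finset.sum_mul, Finset.sum_filter]
    refine Finset.sum_le_sum fun σ _ => ?_
    by_cases hσ : plusCount σ = k
    · rw [if_pos hσ, if_pos (hspin σ hσ)]
      have : columnsWeight lam ℓ h σ
          = Real.exp (-vertEnergy lam ℓ σ) * Real.exp (ℓ * ∑ i, h i * m i) := by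
        rw [columnsWeight_eq, Finset.mul_sum]
        congr 2
        exact Finset.sum_congr rfl fun i _ => by rw [hspin σ hσ i]; ring
      rw [← this]
      split_ifs
      · exact le_rfl
      · exact (columnsWeight_pos ..).le
    · rw [if_neg hσ]
      refine mul_nonneg ?_ (Real.exp_pos _).le
      split_ifs
      · exact (Real.exp_pos _).le
      · exact le_rfl
  · refine le_trans (le_of_eq ?_) hB
    refine Finset.sum_eq_zero fun σ hσ => if_neg fun hall => hadm fun i => ?_
    have h1 := hall i
    rw [hspin σ (Finset.mem_filter.1 hσ).2 i, abs_mul, abs_of_pos hℓ'] at h1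
    exact le_of_mul_le_mul_left h1 hℓ'


/-! ### Two-sided bounds and the two limits. -/

lemma logZmax_eq (lam hext mplus : ℝ) (ℓ : ℕ) :
    logZmax lam hext mplus ℓ
      = sSup (canonicalFunctional lam hext ℓ '' admissibleMag mplus ℓ) := rfl

lemma mem_upperBounds_canonicalFunctional {lam hext mplus P : ℝ} (hlam : 0 < lam) {ℓ : ℕ}
    (hℓ : 1 ≤ ℓ)
    (hP : ∀ t ∈ Set.Icc (-1 : ℝ) 1, Real.log (perron lam (t + hext)) - t ^ 2 / 2 ≤ P) :
    ℓ * (Real.log (traceConst lam) + ℓ * P) ∈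
      upperBounds (canonicalFunctional lam hext ℓ '' admissibleMag mplus ℓ) := by
  rintro _ ⟨m, hm, rfl⟩
  exact canonicalFunctional_le hlam hℓ hP fun i => (hm i).1

lemma logZmax_bounds {lam hext mplus P m s t₀ : ℝ} (hlam : 0 < lam) {ℓ : ℕ} (hℓ : 1 ≤ ℓ)
    (hP : ∀ t ∈ Set.Icc (-1 : ℝ) 1, Real.log (perron lam (t + hext)) - t ^ 2 / 2 ≤ P)
    (ht₀ : Real.log (perron lam (t₀ + hext)) - t₀ ^ 2 / 2 = P) (hs : 0 < s)
    (hm : ∀ i, |mag lam ℓ (fun _ => t₀ + hext) i| ≤ m)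
    (hsmall : ℓ * ((Real.cosh s + m * Real.sinh s) / Real.exp (s * mplus)) ^ ℓ < 1 / 4) :
    ℓ ^ 2 * P - ℓ * Real.log (ℓ + 1) - Real.log 2 ≤ logZmax lam hext mplus ℓ ∧
      logZmax lam hext mplus ℓ ≤ ℓ * (Real.log (traceConst lam) + ℓ * P) := by
  classical
  have hub := mem_upperBounds_canonicalFunctional (mplus := mplus) hlam hℓ hP
  have hZ := ringZ_pos lam ℓ fun _ => t₀ + hext
  have hpow : 0 < ringZ lam ℓ (fun _ => t₀ + hext) ^ ℓ := pow_pos hZ ℓ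
  have hR : ringZ lam ℓ (fun _ => t₀ + hext) ^ ℓ * (1 / 2) ≤ _ :=
    (mul_le_mul_of_nonneg_left (by linarith) hpow.le).trans
      (ringZ_pow_mul_le_sum (mplus := mplus) hs hm)
  -- With no admissible vector, counting with B = 0 would force half of Z^ℓ to be nonpositive.
  have hne : (admissibleMag mplus ℓ).Nonempty := by
    by_contra hempty
    rw [Set.not_nonempty_iff_eq_empty] at hempty
    have := hR.trans (sum_columnsWeight_le le_rfl hℓ (by simp [hempty]))
    rw [mul_zero] at this
    linarith
  refine ⟨?_, by rw [logZmax_eq]; exact csSup_le (hne.image _) hub⟩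
  -- This B dominates every admissible term because (t₀ + hext)μ ≤ μ²/2 + hext μ + t₀²/2, that is,
  -- (μ - t₀)² ≥ 0.
  have hB := hR.trans (sum_columnsWeight_le
    (Real.exp_pos (logZmax lam hext mplus ℓ + ℓ ^ 2 * (t₀ ^ 2 / 2))).le hℓ fun μ hμ => ?_)
  · have h1 := Real.log_le_log (by positivity) hB
    rw [Real.log_mul hpow.ne' (by norm_num), Real.log_mul (by positivity) (Real.exp_pos _).ne',
      Real.log_exp, Real.log_pow, Real.log_pow, one_div, Real.log_inv] at h1
    have h2 := Real.log_le_log (pow_pos (perron_pos lam (t₀ + hext)) ℓ)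
      (perron_pow_le_ringZ hlam hℓ (t₀ + hext))
    rw [Real.log_pow] at h2
    have h3 := mul_le_mul_of_nonneg_left h2 (Nat.cast_nonneg (α := ℝ) ℓ)
    rw [← ht₀]
    linarith
  · have hZμ := multiCanonicalZ_pos lam hℓ fun i => (hμ i).1
    have hle : canonicalFunctional lam hext ℓ μ ≤ logZmax lam hext mplus ℓ := by
      rw [logZmax_eq]; exact le_csSup ⟨_, hub⟩ ⟨μ, hμ, rfl⟩
    rw [canonicalFunctional_eq lam hext hℓ] at hle
    have hsq : 0 ≤ ∑ i, (μ i - t₀) ^ 2 / 2 := Finset.sum_nonneg fun i _ => by positivity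
    have hsplit : ∑ i, (μ i - t₀) ^ 2 / 2
        = ∑ i, (μ i ^ 2 / 2 + hext * μ i) - ∑ i, (t₀ + hext) * μ i + ℓ * (t₀ ^ 2 / 2) := by
      have hconst : (ℓ : ℝ) * (t₀ ^ 2 / 2) = ∑ _i : Fin ℓ, t₀ ^ 2 / 2 := by simp
      rw [hconst, ← Finset.sum_sub_distrib, ← Finset.sum_add_distrib]
      exact Finset.sum_congr rfl fun i _ => by ring
    rw [← Real.exp_log hZμ, ← Real.exp_add, Real.exp_le_exp]
    rw [hsplit] at hsq
    have := mul_nonneg (Nat.cast_nonneg (α := ℝ) ℓ) hsq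
    linarith

lemma fieldFunctional_le {lam hext P : ℝ} (hlam : 0 < lam) {ℓ : ℕ} (hℓ : 1 ≤ ℓ)
    (hP : ∀ t ∈ Set.Icc (-1 : ℝ) 1, Real.log (perron lam (t + hext)) - t ^ 2 / 2 ≤ P)
    (h : Fin ℓ → ℝ) :
    fieldFunctional lam hext ℓ h ≤ Real.log (traceConst lam) + ℓ * P := by
  -- The shift moves h to the field m(h) + hext, where the bound by P applies.
  have h1 := log_ringZ_add_ge lam ℓ h ((fun i => mag lam ℓ h i + hext) - h)
  rw [add_sub_cancel] at h1
  have h2 := log_ringZ_le hlam hℓ hP fun i => mag_mem lam ℓ h i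
  have h3 : ∑ i, ((fun i => mag lam ℓ h i + hext) - h) i * mag lam ℓ h i
      = ∑ i, (mag lam ℓ h i ^ 2 / 2 + (hext - h i) * mag lam ℓ h i)
        + ∑ i, mag lam ℓ h i ^ 2 / 2 := by
    rw [← Finset.sum_add_distrib]
    exact Finset.sum_congr rfl fun i _ => by simp only [Pi.sub_apply]; ring
  rw [h3] at h1
  rw [fieldFunctional]
  linarith

lemma le_fieldFunctional_const {lam hext : ℝ} (hlam : 0 < lam) {ℓ : ℕ} (hℓ : 1 ≤ ℓ) (t : ℝ) :
    ℓ * (Real.log (perron lam (t + hext)) - t ^ 2 / 2)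
      ≤ fieldFunctional lam hext ℓ fun _ => t + hext := by
  have h2 := Real.log_le_log (pow_pos (perron_pos lam (t + hext)) ℓ)
    (perron_pow_le_ringZ hlam hℓ (t + hext))
  rw [Real.log_pow] at h2
  have h1 : ∑ _i : Fin ℓ, -(t ^ 2 / 2) ≤ ∑ i, (mag lam ℓ (fun _ => t + hext) i ^ 2 / 2
      + (hext - (t + hext)) * mag lam ℓ (fun _ => t + hext) i) :=
    Finset.sum_le_sum fun i _ => by nlinarith [sq_nonneg (mag lam ℓ (fun _ => t + hext) i - t)]
  simp only [Finset.sum_const, Finset.card_univ, Fintype.card_fin, nsmul_eq_mul] at h1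
  rw [fieldFunctional]
  linarith

lemma abs_mag_const_le {lam a h : ℝ} (hlam : 0 ≤ lam) (hh : h ∈ Set.Icc (-a) a) (ℓ : ℕ)
    (i : Fin ℓ) : |mag lam ℓ (fun _ => h) i| ≤ Real.tanh (a + 2 * lam) := by
  have h1 := mag_le_tanh hlam ℓ (fun _ => h) i
  have h2 := tanh_le_mag hlam ℓ (fun _ => h) i
  rw [abs_le, ← Real.tanh_neg]
  exact ⟨(tanh_strictMono.monotone (by linarith [hh.1])).trans h2,
    h1.trans (tanh_strictMono.monotone (by linarith [hh.2]))⟩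

/-- Both inequalities are strict at λ = 0 and continuous in λ. -/
lemma exists_coupling_threshold {hstar a mplus : ℝ} (ha : hstar < a - Real.tanh a)
    (hm : Real.tanh a < mplus) :
    ∃ lam₀ : ℝ, 0 < lam₀ ∧ ∀ lam : ℝ, 0 < lam → lam < lam₀ →
      hstar + (Real.exp (2 * lam) - 1) < a - Real.tanh a ∧ Real.tanh (a + 2 * lam) < mplus := by
  have c1 : ContinuousAt (fun lam : ℝ => hstar + (Real.exp (2 * lam) - 1)) 0 := by fun_prop
  have c2 : ContinuousAt (fun lam : ℝ => Real.tanh (a + 2 * lam)) 0 := by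
    refine ContinuousAt.comp (g := Real.tanh) (hasDerivAt_tanh _).continuousAt ?_
    fun_prop
  have e := (c1.eventually_lt_const (u := a - Real.tanh a) (by simpa using ha)).and
    (c2.eventually_lt_const (u := mplus) (by simpa using hm))
  obtain ⟨ε, hε, h⟩ := Metric.eventually_nhds_iff.1 e
  exact ⟨ε, hε, fun lam h0 h1 => h (by rwa [Real.dist_eq, sub_zero, abs_of_pos h0])⟩

lemma tendsto_log_add_one_div : Tendsto (fun ℓ : ℕ => Real.log (ℓ + 1) / ℓ) atTop (𝓝 0) := by
  have h := (Real.tendsto_pow_log_div_mul_add_atTop 1 (-1) 1 one_ne_zero).comp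
    (tendsto_atTop_add_const_right atTop (1 : ℝ) tendsto_natCast_atTop_atTop)
  refine h.congr fun ℓ => ?_
  simp

lemma tendsto_logZmax_div {lam hext mplus P m t₀ : ℝ} (hlam : 0 < lam)
    (hP : ∀ t ∈ Set.Icc (-1 : ℝ) 1, Real.log (perron lam (t + hext)) - t ^ 2 / 2 ≤ P)
    (ht₀ : Real.log (perron lam (t₀ + hext)) - t₀ ^ 2 / 2 = P) (hm0 : 0 ≤ m) (hmp : m < mplus)
    (hm : ∀ ℓ i, |mag lam ℓ (fun _ => t₀ + hext) i| ≤ m) :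
    Tendsto (fun ℓ : ℕ => logZmax lam hext mplus ℓ / (ℓ : ℝ) ^ 2) atTop (𝓝 P) := by
  obtain ⟨s, hs, hlt⟩ := exists_cosh_add_lt_exp hmp
  have hnum : 0 ≤ Real.cosh s + m * Real.sinh s :=
    add_nonneg (Real.cosh_pos s).le (mul_nonneg hm0 (Real.sinh_pos_iff.2 hs).le)
  have hρ := tendsto_self_mul_const_pow_of_lt_one (div_nonneg hnum (Real.exp_pos (s * mplus)).le)
    ((div_lt_one (Real.exp_pos _)).2 hlt)
  have hev := (hρ.eventually_lt_const (u := 1 / 4) (by norm_num)).and (eventually_ge_atTop 1)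
  have hinv : Tendsto (fun ℓ : ℕ => ((ℓ : ℝ))⁻¹) atTop (𝓝 0) := tendsto_inv_atTop_nhds_zero_nat
  have hlow : Tendsto (fun ℓ : ℕ => P - Real.log (ℓ + 1) / ℓ
      - Real.log 2 * ((ℓ : ℝ)⁻¹ * (ℓ : ℝ)⁻¹)) atTop (𝓝 P) := by
    simpa using (tendsto_log_add_one_div.const_sub P).sub ((hinv.mul hinv).const_mul (Real.log 2))
  have hup : Tendsto (fun ℓ : ℕ => P + Real.log (traceConst lam) * (ℓ : ℝ)⁻¹) atTop (𝓝 P) := by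
    simpa using (hinv.const_mul (Real.log (traceConst lam))).const_add P
  refine tendsto_of_tendsto_of_tendsto_of_le_of_le' hlow hup ?_ ?_
  · filter_upwards [hev] with ℓ hℓ
    have hpos : (0 : ℝ) < ℓ := by exact_mod_cast hℓ.2
    have := (logZmax_bounds hlam hℓ.2 hP ht₀ hs (hm ℓ) hℓ.1).1
    rw [le_div_iff₀ (by positivity)]
    refine le_trans (le_of_eq ?_) this
    field_simp
  · filter_upwards [hev] with ℓ hℓ
    have hpos : (0 : ℝ) < ℓ := by exact_mod_cast hℓ.2
    have := (logZmax_bounds hlam hℓ.2 hP ht₀ hs (hm ℓ) hℓ.1).2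
    rw [div_le_iff₀ (by positivity)]
    refine this.trans (le_of_eq ?_)
    field_simp
    ring

end

end LayeredIsing

theorem mainTheorem11
    (hstar : ℝ) (hstar_gt : 3 < hstar) (hstar_eq : 3 / Real.cosh (hstar - 3) ^ 2 = 1 / 4)
    (mstar : ℝ) (mstar_mem : mstar ∈ Set.Ioo (0 : ℝ) 1)
    (mstar_eq : -(deriv LayeredIsing.entropy mstar + mstar) = hstar)
    (mplus : ℝ) (mplus_mem : mplus ∈ Set.Ioo mstar 1) :
    ∃ lam0 : ℝ, 0 < lam0 ∧ ∀ lam : ℝ, 0 < lam → lam < lam0 →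
      (∃ hplus : ℝ, 0 < hplus ∧ LayeredIsing.IsFieldBound lam mplus hplus) ∧
      ∀ hplus : ℝ, 0 < hplus → LayeredIsing.IsFieldBound lam mplus hplus →
        ∀ hext : ℝ, hext ∈ Set.Icc 0 hstar →
          ∃ (P : ℝ) (M : ℕ → ℝ),
            Tendsto (fun ℓ : ℕ => LayeredIsing.logZmax lam hext mplus ℓ / (ℓ : ℝ) ^ 2)
              atTop (𝓝 P) ∧
            (∀ ℓ : ℕ, 1 ≤ ℓ →
              IsGreatest (LayeredIsing.fieldFunctional lam hext ℓ ''
                LayeredIsing.boundedFields hplus ℓ) (M ℓ)) ∧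
            Tendsto (fun ℓ : ℕ => M ℓ / (ℓ : ℝ)) atTop (𝓝 P) := by
  open LayeredIsing in
  obtain ⟨a, ha1, ha2, ha3⟩ := exists_field_threshold mstar_mem mstar_eq mplus_mem
  obtain ⟨lam₀, hlam₀, hthr⟩ := exists_coupling_threshold ha2 ha3
  refine ⟨lam₀, hlam₀, fun lam hlam hlt => ⟨exists_isFieldBound hlam
    ⟨mstar_mem.1.trans mplus_mem.1, mplus_mem.2⟩, fun hplus hp hbound hext hh => ?_⟩⟩
  obtain ⟨hthr1, hthr2⟩ := hthr lam hlam hlt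
  obtain ⟨t₀, ht₀, hle, hmax⟩ := exists_max_pressure hlam hh (by linarith) hthr1
  have hmag : ∀ (ℓ : ℕ) (i : Fin ℓ), |mag lam ℓ (fun _ => t₀ + hext) i| ≤ Real.tanh (a + 2 * lam) :=
    fun ℓ i => abs_mag_const_le hlam.le ⟨by linarith [ht₀.1, hh.1], hle⟩ ℓ i
  choose M hM using exists_isGreatest_fieldFunctional lam hext hp
  have hm0 : 0 ≤ Real.tanh (a + 2 * lam) := by
    rw [← Real.tanh_zero]
    exact tanh_strictMono.monotone (by linarith)
  refine ⟨_, M, tendsto_logZmax_div hlam hmax rfl hm0 hthr2 hmag, fun ℓ _ => hM ℓ, ?_⟩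
  have hinv : Tendsto (fun ℓ : ℕ => ((ℓ : ℝ))⁻¹) atTop (𝓝 0) := tendsto_inv_atTop_nhds_zero_nat
  have hup := (hinv.const_mul (Real.log (traceConst lam))).add_const
    (Real.log (perron lam (t₀ + hext)) - t₀ ^ 2 / 2)
  rw [mul_zero, zero_add] at hup
  refine tendsto_of_tendsto_of_tendsto_of_le_of_le' tendsto_const_nhds hup ?_ ?_
  · filter_upwards [eventually_ge_atTop 1] with ℓ hℓ
    have hpos : (0 : ℝ) < ℓ := by exact_mod_cast hℓ
    rw [le_div_iff₀ hpos, mul_comm]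
    -- The constant field lies in the box because its magnetizations are below m₊, which is what
    -- lets an arbitrary field bound `hplus` be used.
    exact (le_fieldFunctional_const hlam hℓ t₀).trans ((hM ℓ).2
      ⟨_, hbound ℓ hℓ _ fun i => (hmag ℓ i).trans hthr2.le, rfl⟩)
  · filter_upwards [eventually_ge_atTop 1] with ℓ hℓ
    have hpos : (0 : ℝ) < ℓ := by exact_mod_cast hℓ
    obtain ⟨h, _, hMh⟩ := (hM ℓ).1
    rw [div_le_iff₀ hpos, ← hMh]
    refine (fieldFunctional_le hlam hℓ hmax h).trans (le_of_eq ?_)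
    field_simp
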